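/- Let $X$ be a second-countable topological space (for example $\mathbb{R}^d$ or any separable metric space) with its Borel $\sigma$-algebra, let $K \ge 1$, and let $P_0, P_1, \ldots, P_K$ be Markov transition kernels on $X$ which all leave the same probability measure $\pi$ invariant, i.e. $\int P_k(A \mid x)\,\pi(dx) = \pi(A)$ for every Borel set $A$ and $k = 0, \ldots, K$. Suppose that $\pi$ is the only probability measure which is invariant under $P_0$ ($P_0$ is uniquely ergodic). Let $P(\cdot \mid z)$ be a Markov transition kernel on $X^{K+1}$, $z = (z_0, \ldots, z_K)$, which depends on $z$ only through $z_0$, $P(\cdot \mid z) = P(\cdot \mid z_0)$, and whose $k$-th marginal is $P_k$: if $z^* \sim P(\cdot \mid z_0)$, then $z^*_k \sim P_k(\cdot \mid z_0)$ for $k = 0, \ldots, K$. Then there is a Borel set $G \subset X$ with $\pi(G) = 1$, depending only on these data, such that the following holds. Let $\{z^{(i)}\}_{i \ge 1}$, $z^{(i)} = (z^{(i)}_0, \ldots, z^{(i)}_K)$, be any Markov chain on $X^{K+1}$ with transition kernel $P$ such that $z^{(1)}_0 \in G$ almost surely (for instance, the law of $z^{(1)}_0$ is $\pi$ or is absolutely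 continuous with respect to $\pi$, or $z^{(1)}_0$ is a fixed point of $G$). Let $S^{(1)}, S^{(2)}, \ldots$ be i.i.d. random subsets of $\{1, \ldots, K\}$, independent of $\{z^{(i)}\}_{i \ge 1}$, with $\mathbb{P}(S^{(1)} \ne \emptyset) > 0$. Then, almost surely, $$\frac{1}{\sum_{i=1}^N |S^{(i)}|} \sum_{i=1}^N \sum_{k \in S^{(i)}} \delta_{z_k^{(i)}}(\cdot) \;\overset{w}{\to}\; \pi(\cdot) \quad \text{as } N \to \infty,$$ where $\overset{w}{\to}$ denotes weak convergence of measures (convergence of the integrals of all bounded continuous functions). -/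

import Mathlib

open MeasureTheory ProbabilityTheory Filter Topology
open scoped NNReal

universe u v

/-- A transition kernel with exactly one stationary probability measure. -/
def UniquelyErgodic {X : Type*} [MeasurableSpace X] (κ : Kernel X X) : Prop :=
  ∃! ν : ProbabilityMeasure X, Kernel.Invariant κ (ν : Measure X)

/-- The random sequence `z 0, z 1, …` on `(Ω, μ)` is a time-homogeneous Markov chain with
transition kernel `Q` (and arbitrary initial law): conditionally on the whole history
`z 0, …, z i`, the next state `z (i + 1)` is distributed according to `Q (z i)`. -/
structure IsMarkovChain {Ω E : Type*} [MeasurableSpace Ω] [MeasurableSpace E]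
    (Q : Kernel E E) (z : ℕ → Ω → E) (μ : Measure Ω) : Prop where
  measurable : ∀ i, Measurable (z i)
  markov : ∀ i : ℕ,
    HasCondDistrib (z (i + 1)) (fun ω (j : Finset.Iic i) => z j ω)
      (Q.comap (fun h : Finset.Iic i → E => h ⟨i, Finset.mem_Iic.2 le_rfl⟩)
        (measurable_pi_apply _)) μ

/-- The empirical measure `(∑ i < N, |S i|)⁻¹ • ∑ i < N, ∑ k ∈ S i, δ_{z i k}` of the states
selected by the index sets `S i ⊆ {1, …, K}`. The element `k : Fin K` of an index set stands for
the index `k + 1` in `{1, …, K}`, that is, for the coordinate `k.succ` of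
`z i = (z i 0, …, z i K)`. It is the zero measure when all the sets `S i`, `i < N`, are empty. -/
noncomputable def recycledEmpirical {X : Type*} [MeasurableSpace X] {K : ℕ}
    (S : ℕ → Finset (Fin K)) (z : ℕ → Fin (K + 1) → X) (N : ℕ) : FiniteMeasure X :=
  (((∑ i ∈ Finset.range N, (S i).card : ℕ) : ℝ≥0)⁻¹) •
    ∑ i ∈ Finset.range N, ∑ k ∈ S i, (diracProba (z i k.succ)).toFiniteMeasure

/-! In a second-countable space, weak convergence to π follows from convergence of the masses of the
sets V of one countable π-system of open sets containing arbitrarily small neighbourhoods;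
countability leaves a single null set. For such V and an index k, split the weight 1{k ∈ S i} into
its mean w k and a centred part. The centred parts, multiplied by the indicator of V at `z i
k.succ`, are bounded and pairwise orthogonal, since the weights are independent of each other and of
the chain, so their averages vanish almost surely (`ae_tendsto_average_weight_mul`). The mean part
needs an ergodic theorem for the chain on the product space.

Coordinate 0 drives that chain: the 0-th marginal of an invariant law is invariant under P_0, hence
equals π, and the invariant law must be πP (`UniquelyErgodic.comap`). Every marginal of πP is π, so
the averages tend to w k π(V), however the coordinates depend on each other. Summing over k and
dividing by the counts, which grow like N ∑ w k, leaves π(V).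

Unique ergodicity forces bounded harmonic functions to be almost surely constant, which makes
shift-invariant events trivial; the maximal ergodic theorem then yields pointwise convergence for
the stationary chain. For other initial laws, the second state depends on the first only through
coordinate 0. So G consists of the points x from which the path launched with law P x almost surely
avoids a measurable null set of bad paths; the remaining initial coordinates are irrelevant, and
omitting the first term does not change limits of averages. -/

/-! ### Maximal inequality and laws of large numbers -/

/-- **Maximal ergodic theorem** for bounded functions. -/
theorem MeasureTheory.MeasurePreserving.integral_nonneg_of_ae_exists_birkhoffSum_pos
    {α : Type*} [MeasurableSpace α] {μ : Measure α} [IsFiniteMeasure μ] {T : α → α}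
    (hT : MeasurePreserving T μ μ) {g : α → ℝ} (hg : Measurable g) {C : ℝ} (hC : ∀ x, |g x| ≤ C)
    (hpos : ∀ᵐ x ∂μ, ∃ N, 0 < birkhoffSum T g N x) : 0 ≤ ∫ x, g x ∂μ := by
  -- Garsia's argument: m n is the maximum of the Birkhoff sums of lengths 0, …, n, written
  -- recursively so that m (n + 1) = g + m n ∘ T wherever m (n + 1) is positive.
  obtain ⟨m, m_zero, m_succ⟩ : ∃ m : ℕ → α → ℝ, (∀ x, m 0 x = 0) ∧
      ∀ n x, m (n + 1) x = max 0 (g x + m n (T x)) :=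
    ⟨fun n => Nat.rec (fun _ => 0) (fun _ f x => max 0 (g x + f (T x))) n,
      fun _ => rfl, fun _ _ => rfl⟩
  have m_nonneg : ∀ n x, 0 ≤ m n x := by
    intro n x
    cases n with
    | zero => simp [m_zero]
    | succ n => simp [m_succ]
  have m_meas : ∀ n, Measurable (m n) := by
    intro n
    induction n with
    | zero => simpa only [funext m_zero] using measurable_const
    | succ n ih =>
      rw [funext (m_succ n)]
      exact measurable_const.max (hg.add (ih.comp hT.measurable))
  have m_le : ∀ n x, m n x ≤ n * C := by
    intro n
    induction n with
    | zero => intro x; simp [m_zero]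
    | succ n ih =>
      intro x
      have h1 := ih (T x)
      have h2 := abs_le.1 (hC x)
      have h3 : 0 ≤ C := (abs_nonneg _).trans (hC x)
      rw [m_succ]
      push_cast
      refine max_le (by positivity) (by linarith)
  have m_int : ∀ n, Integrable (m n) μ := fun n =>
    Integrable.of_bound (m_meas n).aestronglyMeasurable (n * C)
      (ae_of_all _ fun x => by rw [Real.norm_of_nonneg (m_nonneg n x)]; exact m_le n x)
  have m_mono_succ : ∀ n x, m n x ≤ m (n + 1) x := by
    intro n
    induction n with
    | zero => intro x; rw [m_zero]; exact m_nonneg 1 x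
    | succ n ih =>
      intro x
      rw [m_succ, m_succ (n + 1)]
      gcongr
      exact ih _
  have sum_le : ∀ n x, birkhoffSum T g n x ≤ m n x := by
    intro n
    induction n with
    | zero => intro x; simp [m_zero]
    | succ n ih =>
      intro x
      rw [birkhoffSum_succ', m_succ]
      exact le_max_of_le_right (by linarith [ih (T x)])
  have g_int : Integrable g μ := Integrable.of_bound hg.aestronglyMeasurable C (ae_of_all _ hC)
  let s : ℕ → Set α := fun n => {x | 0 < m n x}
  have s_meas : ∀ n, MeasurableSet (s n) := fun n => measurableSet_lt measurable_const (m_meas n)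
  have s_mono : Monotone s :=
    monotone_nat_of_le_succ fun n x (hx : 0 < m n x) => hx.trans_le (m_mono_succ n x)
  have s_nonneg : ∀ n, 0 ≤ ∫ x in s n, g x ∂μ := by
    intro n
    cases n with
    | zero => simp [s, m_zero]
    | succ n =>
      rw [← integral_indicator (s_meas (n + 1))]
      have hcomp : Integrable (fun x => m n (T x)) μ := hT.integrable_comp_of_integrable (m_int n)
      have heq : ∫ x, m n (T x) ∂μ = ∫ x, m n x ∂μ := by
        rw [← integral_map hT.measurable.aemeasurable
          (by rw [hT.map_eq]; exact (m_meas n).aestronglyMeasurable), hT.map_eq]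
      -- Invariance lets m n ∘ T replace m n under the integral. The difference m (n + 1) - m n ∘ T
      -- equals g on `s (n + 1)` and is at most 0 elsewhere.
      calc 0 ≤ ∫ x, m (n + 1) x ∂μ - ∫ x, m n x ∂μ :=
            sub_nonneg.2 (integral_mono (m_int n) (m_int (n + 1)) (m_mono_succ n))
        _ = ∫ x, (m (n + 1) x - m n (T x)) ∂μ := by rw [integral_sub (m_int (n + 1)) hcomp, heq]
        _ ≤ ∫ x, (s (n + 1)).indicator g x ∂μ := by
            refine integral_mono ((m_int (n + 1)).sub hcomp) (g_int.indicator (s_meas (n + 1))) fun x => ?_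
            by_cases hx : x ∈ s (n + 1)
            · rw [Set.indicator_of_mem hx]
              have hx' : 0 < m (n + 1) x := hx
              rw [m_succ, lt_max_iff] at hx'
              have := hx'.resolve_left (lt_irrefl _)
              simp only [m_succ, max_eq_right this.le]
              linarith
            · rw [Set.indicator_of_notMem hx]
              have hx' : m (n + 1) x ≤ 0 := not_lt.1 hx
              linarith [m_nonneg n (T x)]
  have hlim := tendsto_setIntegral_of_monotone s_meas s_mono g_int.integrableOn
  have hunion : (⋃ n, s n) =ᵐ[μ] Set.univ := by
    rw [ae_eq_univ]
    refine measure_mono_null (fun x hx => ?_) hpos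
    rintro ⟨N, hN⟩
    exact hx (Set.mem_iUnion.2 ⟨N, hN.trans_le (sum_le N x)⟩)
  rw [setIntegral_congr_set hunion, setIntegral_univ] at hlim
  exact ge_of_tendsto' hlim s_nonneg

/-- Between s² and the next square there are at most 2s further terms, contributing at most 2sC / s²
to the average, which tends to 0. -/
theorem tendsto_average_of_tendsto_average_sq {u : ℕ → ℝ} {C : ℝ} (hu : ∀ i, |u i| ≤ C)
    (h : Tendsto (fun n : ℕ => (∑ i ∈ Finset.range (n ^ 2), u i) / (n : ℝ) ^ 2) atTop (𝓝 0)) :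
    Tendsto (fun n : ℕ => (∑ i ∈ Finset.range n, u i) / n) atTop (𝓝 0) := by
  have hsqrt : Tendsto Nat.sqrt atTop atTop := by
    refine tendsto_atTop.2 fun b => ?_
    filter_upwards [eventually_ge_atTop (b * b)] with n hn
    exact Nat.le_sqrt.2 hn
  have hC : 0 ≤ C := (abs_nonneg _).trans (hu 0)
  have h1 : Tendsto (fun n : ℕ => |(∑ i ∈ Finset.range (n.sqrt ^ 2), u i) / (n.sqrt : ℝ) ^ 2|
      + 2 * C / n.sqrt) atTop (𝓝 0) := by
    have h2 : Tendsto (fun n : ℕ => 2 * C / (n : ℝ)) atTop (𝓝 0) :=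
      tendsto_const_div_atTop_nhds_zero_nat _
    simpa using (h.comp hsqrt).abs.add (h2.comp hsqrt)
  refine squeeze_zero_norm' ?_ h1
  filter_upwards [eventually_ge_atTop 1] with n hn
  have hs1 : 1 ≤ n.sqrt := Nat.le_sqrt.2 (by simpa using hn)
  have hs2 : n.sqrt ^ 2 ≤ n := Nat.sqrt_le' n
  have hs3 : n ≤ n.sqrt ^ 2 + 2 * n.sqrt := by
    have := Nat.sqrt_le_add n
    nlinarith
  set s := n.sqrt
  have hsplit : ∑ i ∈ Finset.range n, u i
      = ∑ i ∈ Finset.range (s ^ 2), u i + ∑ i ∈ Finset.Ico (s ^ 2) n, u i := by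
    rw [Finset.sum_range_add_sum_Ico _ hs2]
  have htail : |∑ i ∈ Finset.Ico (s ^ 2) n, u i| ≤ 2 * s * C := by
    calc |∑ i ∈ Finset.Ico (s ^ 2) n, u i| ≤ ∑ i ∈ Finset.Ico (s ^ 2) n, |u i| :=
          Finset.abs_sum_le_sum_abs _ _
      _ ≤ ∑ i ∈ Finset.Ico (s ^ 2) n, C := Finset.sum_le_sum fun i _ => hu i
      _ = ((n - s ^ 2 : ℕ) : ℝ) * C := by simp
      _ ≤ 2 * s * C := by
          gcongr
          have : n - s ^ 2 ≤ 2 * s := by omega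
          exact_mod_cast this
  have hs0 : (0 : ℝ) < s := by exact_mod_cast hs1
  have hsn : (s : ℝ) ^ 2 ≤ n := by exact_mod_cast hs2
  rw [Real.norm_eq_abs, hsplit, abs_div, Nat.abs_cast, abs_div, abs_of_pos (pow_pos hs0 2)]
  calc |∑ i ∈ Finset.range (s ^ 2), u i + ∑ i ∈ Finset.Ico (s ^ 2) n, u i| / (n : ℝ)
      ≤ (|∑ i ∈ Finset.range (s ^ 2), u i| + 2 * s * C) / (s : ℝ) ^ 2 := by
        gcongr
        exact (abs_add_le _ _).trans (by gcongr)
    _ = |∑ i ∈ Finset.range (s ^ 2), u i| / (s : ℝ) ^ 2 + 2 * C / s := by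
        field_simp

/-- Strong law of large numbers for bounded, pairwise orthogonal random variables. -/
theorem ae_tendsto_average_zero_of_orthogonal {Ω : Type*} [MeasurableSpace Ω] {μ : Measure Ω}
    [IsProbabilityMeasure μ] {D : ℕ → Ω → ℝ} (hD : ∀ i, Measurable (D i)) {C : ℝ}
    (hC : ∀ i ω, |D i ω| ≤ C) (horth : ∀ i j, i ≠ j → ∫ ω, D i ω * D j ω ∂μ = 0) :
    ∀ᵐ ω ∂μ, Tendsto (fun n : ℕ => (∑ i ∈ Finset.range n, D i ω) / n) atTop (𝓝 0) := by
  have hbdd : ∀ i j ω, ‖D i ω * D j ω‖ ≤ C ^ 2 := fun i j ω => by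
    rw [norm_mul, sq]
    exact mul_le_mul (hC i ω) (hC j ω) (norm_nonneg _) ((abs_nonneg _).trans (hC i ω))
  have hint : ∀ i j, Integrable (fun ω => D i ω * D j ω) μ := fun i j =>
    Integrable.of_bound ((hD i).mul (hD j)).aestronglyMeasurable (C ^ 2) (ae_of_all _ (hbdd i j))
  have hsq : ∀ n : ℕ, ∫ ω, (∑ i ∈ Finset.range n, D i ω) ^ 2 ∂μ ≤ n * C ^ 2 := by
    intro n
    simp_rw [sq (∑ i ∈ Finset.range n, D i _), Finset.sum_mul_sum]
    rw [integral_finsetSum _ fun i _ => integrable_finsetSum _ fun j _ => hint i j]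
    calc ∑ i ∈ Finset.range n, ∫ ω, ∑ j ∈ Finset.range n, D i ω * D j ω ∂μ
        ≤ ∑ i ∈ Finset.range n, C ^ 2 := by
          refine Finset.sum_le_sum fun i hi => ?_
          rw [integral_finsetSum _ fun j _ => hint i j,
            Finset.sum_eq_single_of_mem i hi fun j _ hj => horth i j hj.symm]
          calc ∫ ω, D i ω * D i ω ∂μ ≤ ∫ _, C ^ 2 ∂μ :=
                integral_mono (hint i i) (integrable_const _)
                  fun ω => (le_abs_self _).trans (hbdd i i ω)
            _ = C ^ 2 := by simp
      _ = n * C ^ 2 := by simp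
  -- The second moment of a sum of n terms is at most nC², so the squared average over (n + 1)²
  -- terms has mean at most C² / (n + 1)². This is summable, hence the series of the Y n converges
  -- almost surely and its terms tend to 0.
  let Y : ℕ → Ω → ℝ := fun n ω =>
    ((∑ i ∈ Finset.range ((n + 1) ^ 2), D i ω) / ((n + 1 : ℕ) : ℝ) ^ 2) ^ 2
  have hYmeas : ∀ n, Measurable (Y n) := fun n =>
    ((Finset.measurable_sum _ fun i _ => hD i).div_const _).pow_const 2
  have hYle : ∀ n, ∫⁻ ω, ENNReal.ofReal (Y n ω) ∂μ
      ≤ ENNReal.ofReal (C ^ 2 * (1 / ((n + 1 : ℕ) : ℝ) ^ 2)) := by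
    intro n
    have hYint : Integrable (Y n) μ := by
      have : Integrable (fun ω => (∑ i ∈ Finset.range ((n + 1) ^ 2), D i ω) ^ 2) μ := by
        simp_rw [sq (∑ i ∈ Finset.range _, D i _), Finset.sum_mul_sum]
        exact integrable_finsetSum _ fun i _ => integrable_finsetSum _ fun j _ => hint i j
      simpa only [Y, div_pow] using this.div_const _
    rw [← ofReal_integral_eq_lintegral_ofReal hYint (ae_of_all _ fun ω => sq_nonneg _)]
    refine ENNReal.ofReal_le_ofReal ?_
    simp only [Y, div_pow]
    rw [integral_div]
    have h0 : (0 : ℝ) < ((n + 1 : ℕ) : ℝ) := by positivity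
    rw [div_le_iff₀ (by positivity)]
    refine (hsq _).trans (le_of_eq ?_)
    push_cast
    field_simp
  have hsum : ∑' n, ∫⁻ ω, ENNReal.ofReal (Y n ω) ∂μ ≠ ⊤ := by
    have hs : Summable fun n : ℕ => C ^ 2 * (1 / ((n + 1 : ℕ) : ℝ) ^ 2) :=
      ((summable_nat_add_iff 1).2 (Real.summable_one_div_nat_pow.2 one_lt_two)).mul_left _
    refine ne_top_of_le_ne_top ?_ (ENNReal.tsum_le_tsum hYle)
    rw [← ENNReal.ofReal_tsum_of_nonneg (fun n => by positivity) hs]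
    exact ENNReal.ofReal_ne_top
  rw [← lintegral_tsum fun n => (hYmeas n).ennreal_ofReal.aemeasurable] at hsum
  have hfin := ae_lt_top' (AEMeasurable.tsum fun n => (hYmeas n).ennreal_ofReal.aemeasurable) hsum
  filter_upwards [hfin] with ω hω
  refine tendsto_average_of_tendsto_average_sq (C := C) (fun i => hC i ω) ?_
  have h0 := ENNReal.tendsto_atTop_zero_of_tsum_ne_top hω.ne
  have h1 : Tendsto (fun n => Y n ω) atTop (𝓝 0) := by
    have := (ENNReal.tendsto_toReal ENNReal.zero_ne_top).comp h0
    simpa [Function.comp_def, ENNReal.toReal_ofReal, Y, sq_nonneg] using this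
  have h2 : Tendsto (fun n : ℕ => (∑ i ∈ Finset.range ((n + 1) ^ 2), D i ω)
      / ((n + 1 : ℕ) : ℝ) ^ 2) atTop (𝓝 0) := by
    have := h1.sqrt
    simp only [Y, Real.sqrt_sq_eq_abs, Real.sqrt_zero] at this
    exact (tendsto_zero_iff_abs_tendsto_zero _).2 this
  exact (tendsto_add_atTop_iff_nat (f := fun n : ℕ => (∑ i ∈ Finset.range (n ^ 2), D i ω)
    / (n : ℝ) ^ 2) 1).1 h2

/-- Needed because a chain with a general initial law is controlled only from its second state on.
-/
theorem tendsto_average_of_tendsto_average_succ {u : ℕ → ℝ} {l : ℝ}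
    (h : Tendsto (fun n : ℕ => (∑ i ∈ Finset.range n, u (i + 1)) / n) atTop (𝓝 l)) :
    Tendsto (fun n : ℕ => (∑ i ∈ Finset.range n, u i) / n) atTop (𝓝 l) := by
  rw [← tendsto_add_atTop_iff_nat 1]
  have h1 : Tendsto (fun n : ℕ => u 0 / ((n + 1 : ℕ) : ℝ)) atTop (𝓝 0) :=
    (tendsto_add_atTop_iff_nat 1).2 (tendsto_const_div_atTop_nhds_zero_nat (u 0))
  have h2 : Tendsto (fun n : ℕ => (n : ℝ) / (n + 1 : ℝ)) atTop (𝓝 1) :=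
    tendsto_natCast_div_add_atTop 1
  have h3 := (h.mul h2).add h1
  rw [mul_one, add_zero] at h3
  refine h3.congr' ?_
  filter_upwards [eventually_ge_atTop 1] with n hn
  have : (n : ℝ) ≠ 0 := by positivity
  rw [Finset.sum_range_succ']
  push_cast
  field_simp

/-! ### Path laws of Markov chains -/

section PathMeasure

variable {E : Type*} [MeasurableSpace E]

/-- The kernel sending a finite history to the law of the next state of a chain with transition
kernel `Q`. -/
noncomputable abbrev lastStateKernel (Q : Kernel E E) (n : ℕ) : Kernel (Finset.Iic n → E) E :=
  Q.comap (fun h : Finset.Iic n → E => h ⟨n, Finset.mem_Iic.2 le_rfl⟩) (measurable_pi_apply _)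

/-- The law of the whole path of a Markov chain with transition kernel `Q`, as a function of its
starting point. -/
noncomputable def pathKernel (Q : Kernel E E) [IsMarkovKernel Q] : Kernel E (ℕ → E) :=
  (Kernel.traj (X := fun _ => E) (lastStateKernel Q) 0).comap (fun x _ => x)
    (measurable_pi_lambda _ fun _ => measurable_id)

/-- The left shift on sequences. -/
def pathShift (x : ℕ → E) : ℕ → E := fun i => x (i + 1)

theorem measurable_pathShift : Measurable (pathShift (E := E)) :=
  measurable_pi_lambda _ fun _ => measurable_pi_apply _

instance (Q : Kernel E E) [IsMarkovKernel Q] : IsMarkovKernel (pathKernel Q) := by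
  unfold pathKernel; infer_instance

theorem pathKernel_map_zero (Q : Kernel E E) [IsMarkovKernel Q] :
    (pathKernel Q).map (fun x => x 0) = Kernel.id := by
  ext1 x
  have h := Kernel.traj_map_frestrictLe_apply (X := fun _ => E) (κ := lastStateKernel Q) 0 0
    (fun _ => x)
  rw [Kernel.partialTraj_self, Kernel.id_apply] at h
  have h2 := congrArg (Measure.map fun y : Finset.Iic 0 → E => y ⟨0, Finset.mem_Iic.2 le_rfl⟩) h
  rw [Measure.map_map (by fun_prop) (by fun_prop), Measure.map_dirac' (by fun_prop)] at h2
  rw [Kernel.map_apply _ (by fun_prop), Kernel.id_apply]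
  exact h2

theorem map_zero_bind_pathKernel (Q : Kernel E E) [IsMarkovKernel Q] (ρ : Measure E) :
    (ρ.bind (pathKernel Q)).map (fun x => x 0) = ρ := by
  rw [Measure.map_comp _ _ (by fun_prop), pathKernel_map_zero, Measure.id_comp]

/-- The Ionescu-Tulcea measure provides the canonical model to which the law of any chain is
compared. -/
theorem isMarkovChain_bind_pathKernel (Q : Kernel E E) [IsMarkovKernel Q] (ρ : Measure E)
    [IsFiniteMeasure ρ] : IsMarkovChain Q (fun i x => x i) (ρ.bind (pathKernel Q)) where
  measurable i := measurable_pi_apply i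
  markov i := by
    refine ⟨by fun_prop, Eq.symm ?_⟩
    change (ρ.bind (pathKernel Q)).map (Preorder.frestrictLe i) ⊗ₘ lastStateKernel Q i = _
    have hm : Measurable fun x : ℕ → E => ((fun j : Finset.Iic i => x j), x (i + 1)) := by
      fun_prop
    rw [Measure.compProd_eq_comp_prod, Measure.map_comp _ _ (by fun_prop),
      Measure.comp_assoc, Measure.map_comp _ _ hm]
    congr 1
    ext1 x
    have h := Kernel.partialTraj_compProd_eq_map_traj (X := fun _ => E)
      (κ := lastStateKernel Q) (Nat.zero_le i) (x₀ := fun _ => x)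
    rw [Kernel.comp_apply, ← Measure.compProd_eq_comp_prod, Kernel.map_apply _ hm,
      Kernel.map_apply _ (by fun_prop)]
    refine Eq.trans ?_ h
    congr 1
    exact Kernel.traj_map_frestrictLe_apply (X := fun _ => E) (κ := lastStateKernel Q) 0 i
      (fun _ => x)

/-- Each finite set of times lies in an initial segment, so both measures are projective limits of
the same finite-dimensional laws. No topology on E is required. -/
theorem measure_pi_nat_ext {M M' : Measure (ℕ → E)} [IsFiniteMeasure M] [IsFiniteMeasure M']
    (h : ∀ n : ℕ, M.map (fun (x : ℕ → E) (j : Finset.Iic n) => x (j : ℕ))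
      = M'.map (fun (x : ℕ → E) (j : Finset.Iic n) => x (j : ℕ))) :
    M = M' := by
  have hall : ∀ I : Finset ℕ, M'.map I.restrict = M.map I.restrict := by
    intro I
    have hsub : I ⊆ Finset.Iic (I.sup id) := I.subset_Iic_sup_id
    have key : ∀ N : Measure (ℕ → E), N.map I.restrict
        = (N.map (fun (x : ℕ → E) (j : Finset.Iic (I.sup id)) => x (j : ℕ))).map
          (fun y (j : I) => y ⟨j, hsub j.2⟩) := fun N => by
      rw [Measure.map_map (by fun_prop) (by fun_prop)]
      rfl
    rw [key, key, h]
  exact IsProjectiveLimit.unique (P := fun I : Finset ℕ => M.map I.restrict) (fun _ => rfl) hall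

end PathMeasure

/-! ### Uniqueness in law and the Markov property -/

namespace IsMarkovChain

variable {Ω E : Type*} [MeasurableSpace Ω] [MeasurableSpace E] {Q : Kernel E E}
  {z : ℕ → Ω → E} {μ : Measure Ω}

theorem measurable_path (hz : IsMarkovChain Q z μ) : Measurable fun ω i => z i ω :=
  measurable_pi_lambda _ hz.measurable

theorem measurable_history (hz : IsMarkovChain Q z μ) (n : ℕ) :
    Measurable fun ω (j : Finset.Iic n) => z j ω :=
  measurable_pi_lambda _ fun j => hz.measurable j

theorem map_history_zero (hz : IsMarkovChain Q z μ) :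
    μ.map (fun ω (j : Finset.Iic 0) => z j ω)
      = (μ.map (z 0)).map fun (x : E) (_ : Finset.Iic 0) => x := by
  rw [Measure.map_map (by fun_prop) (hz.measurable 0)]
  congr 1
  funext ω j
  have : (j : ℕ) = 0 := Nat.le_zero.1 (Finset.mem_Iic.1 j.2)
  simp [this]

theorem map_history_succ (hz : IsMarkovChain Q z μ) (n : ℕ) :
    μ.map (fun ω (j : Finset.Iic (n + 1)) => z j ω)
      = (μ.map (fun ω (j : Finset.Iic n) => z j ω) ⊗ₘ lastStateKernel Q n).map
        (fun p (j : Finset.Iic (n + 1)) =>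
          if h : (j : ℕ) ≤ n then p.1 ⟨j, Finset.mem_Iic.2 h⟩ else p.2) := by
  have hg : Measurable fun (p : (Finset.Iic n → E) × E) (j : Finset.Iic (n + 1)) =>
      if h : (j : ℕ) ≤ n then p.1 ⟨j, Finset.mem_Iic.2 h⟩ else p.2 := by
    refine measurable_pi_lambda _ fun j => ?_
    by_cases h : (j : ℕ) ≤ n
    · simp only [h, dif_pos]; fun_prop
    · simp only [h, dif_neg, not_false_eq_true]; fun_prop
  rw [← (hz.markov n).map_eq,
    Measure.map_map hg ((hz.measurable_history n).prodMk (hz.measurable (n + 1)))]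
  congr 1
  funext ω j
  by_cases h : (j : ℕ) ≤ n
  · simp [h]
  · have : (j : ℕ) = n + 1 := le_antisymm (Finset.mem_Iic.1 j.2) (by omega)
    simp [this]

theorem map_history_eq {Ω' : Type*} [MeasurableSpace Ω'] {μ' : Measure Ω'} {z' : ℕ → Ω' → E}
    (hz : IsMarkovChain Q z μ) (hz' : IsMarkovChain Q z' μ')
    (h0 : μ.map (z 0) = μ'.map (z' 0)) (n : ℕ) :
    μ.map (fun ω (j : Finset.Iic n) => z j ω) = μ'.map (fun ω (j : Finset.Iic n) => z' j ω) := by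
  induction n with
  | zero => rw [hz.map_history_zero, hz'.map_history_zero, h0]
  | succ n ih => rw [hz.map_history_succ, hz'.map_history_succ, ih]

/-- The law of a Markov chain is determined by its transition kernel and its initial law. -/
theorem map_path [IsMarkovKernel Q] [IsFiniteMeasure μ] (hz : IsMarkovChain Q z μ) :
    μ.map (fun ω i => z i ω) = (μ.map (z 0)).bind (pathKernel Q) := by
  have hP := isMarkovChain_bind_pathKernel Q (μ.map (z 0))
  refine measure_pi_nat_ext fun n => ?_
  rw [Measure.map_map (by fun_prop) hz.measurable_path]
  exact hz.map_history_eq hP (map_zero_bind_pathKernel Q _).symm n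

/-- The Markov property: after time `n`, and on an event of the past of `n`, a Markov chain
is again a Markov chain with the same transition kernel. -/
theorem shift_restrict [IsMarkovKernel Q] [IsFiniteMeasure μ] (hz : IsMarkovChain Q z μ) (n : ℕ)
    {B : Set (Finset.Iic n → E)} (hB : MeasurableSet B) :
    IsMarkovChain Q (fun i => z (n + i))
      (μ.restrict ((fun ω (j : Finset.Iic n) => z j ω) ⁻¹' B)) where
  measurable i := hz.measurable _
  markov i := by
    set A := (fun ω (j : Finset.Iic n) => z j ω) ⁻¹' B
    let X : Ω → Finset.Iic (n + i) → E := fun ω j => z j ω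
    let r : (Finset.Iic (n + i) → E) → Finset.Iic n → E :=
      fun h j => h ⟨j, Finset.mem_Iic.2 ((Finset.mem_Iic.1 j.2).trans (Nat.le_add_right n i))⟩
    have hr : Measurable r := by fun_prop
    have hX : Measurable X := hz.measurable_history (n + i)
    have hA : A = X ⁻¹' (r ⁻¹' B) := rfl
    have hXY : Measurable fun ω => (X ω, z (n + i + 1) ω) := hX.prodMk (hz.measurable _)
    have hcond : HasCondDistrib (z (n + i + 1)) X (lastStateKernel Q (n + i)) (μ.restrict A) := by
      refine ⟨hXY.aemeasurable, ?_⟩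
      -- The event A constrains only the history, so restricting to it restricts the first factor of
      -- the composition-product and leaves the kernel unchanged.
      have hpre : A = (fun ω => (X ω, z (n + i + 1) ω)) ⁻¹' ((r ⁻¹' B) ×ˢ Set.univ) := by
        rw [hA]; ext ω; simp
      rw [hpre, ← Measure.restrict_map hXY ((hr hB).prod .univ), (hz.markov (n + i)).map_eq,
        ← hpre, hA, ← Measure.restrict_map hX (hr hB)]
      ext s hs
      rw [Measure.restrict_apply hs, Measure.compProd_apply (hs.inter ((hr hB).prod .univ)),
        Measure.compProd_apply hs, ← lintegral_indicator (hr hB)]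
      refine lintegral_congr fun h => ?_
      by_cases hh : h ∈ r ⁻¹' B
      · rw [Set.indicator_of_mem hh]
        congr 1
        ext y
        simp [show r h ∈ B from hh]
      · rw [Set.indicator_of_notMem hh]
        have : Prod.mk h ⁻¹' (s ∩ (r ⁻¹' B) ×ˢ Set.univ) = ∅ := by
          ext y
          simp [show r h ∉ B from hh]
        rw [this, measure_empty]
    -- Forgetting the states before time n is harmless: the kernel reads only the last state, which
    -- f keeps.
    let f : (Finset.Iic (n + i) → E) → Finset.Iic i → E :=
      fun h j => h ⟨n + j, Finset.mem_Iic.2 (Nat.add_le_add_left (Finset.mem_Iic.1 j.2) n)⟩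
    have hf : Measurable f := by fun_prop
    exact HasCondDistrib.comp_right (κ := lastStateKernel Q i) (f := f) (hf := hf) hcond

theorem map_shift_restrict [IsMarkovKernel Q] [IsFiniteMeasure μ] (hz : IsMarkovChain Q z μ)
    (n : ℕ) {B : Set (Finset.Iic n → E)} (hB : MeasurableSet B) :
    (μ.restrict ((fun ω (j : Finset.Iic n) => z j ω) ⁻¹' B)).map (fun ω i => z (n + i) ω)
      = ((μ.restrict ((fun ω (j : Finset.Iic n) => z j ω) ⁻¹' B)).map (z n)).bind
        (pathKernel Q) :=
  (hz.shift_restrict n hB).map_path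

theorem map_shift [IsMarkovKernel Q] [IsFiniteMeasure μ] (hz : IsMarkovChain Q z μ) (n : ℕ) :
    μ.map (fun ω i => z (n + i) ω) = (μ.map (z n)).bind (pathKernel Q) := by
  simpa using hz.map_shift_restrict n (B := Set.univ) .univ

theorem map_succ [IsMarkovKernel Q] [IsFiniteMeasure μ] (hz : IsMarkovChain Q z μ) (n : ℕ) :
    μ.map (z (n + 1)) = (μ.map (z n)).bind Q := by
  have h : HasCondDistrib (z (n + 1)) (z n) Q μ :=
    HasCondDistrib.comp_right (f := fun h : Finset.Iic n → E => h ⟨n, Finset.mem_Iic.2 le_rfl⟩)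
      (hf := measurable_pi_apply _) (hz.markov n)
  have h2 := congrArg Measure.snd h.map_eq
  rwa [Measure.snd_compProd, Measure.snd_map_prodMk (hz.measurable n)] at h2

end IsMarkovChain

/-! ### Ergodicity and the pointwise ergodic theorem -/

section Ergodic

variable {E : Type*} [MeasurableSpace E] {Q : Kernel E E} [IsMarkovKernel Q]

/-- If a set is preserved by a uniquely ergodic kernel, almost surely for its stationary law,
then it is trivial. -/
theorem UniquelyErgodic.measure_eq_zero_or_compl (hQ : UniquelyErgodic Q) {ρ : Measure E}
    [IsProbabilityMeasure ρ] (hρ : Kernel.Invariant Q ρ) {B : Set E} (hB : MeasurableSet B)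
    (h : ∀ᵐ p ∂(ρ ⊗ₘ Q), p.1 ∈ B ↔ p.2 ∈ B) : ρ B = 0 ∨ ρ Bᶜ = 0 := by
  by_cases h0 : ρ B = 0
  · exact Or.inl h0
  right
  -- Almost no mass crosses the boundary of B, so ρ restricted to B is invariant; normalised, it
  -- must equal ρ by uniqueness.
  have hinv : (ρ.restrict B).bind Q = ρ.restrict B := by
    ext A hA
    rw [Measure.bind_apply hA Q.measurable.aemeasurable, Measure.restrict_apply hA,
      ← Measure.compProd_apply_prod hB hA]
    have h1 : (ρ ⊗ₘ Q) (B ×ˢ A) = (ρ ⊗ₘ Q) (Prod.snd ⁻¹' (A ∩ B)) := by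
      refine measure_congr ?_
      filter_upwards [h] with p hp
      refine propext ?_
      change (p.1 ∈ B ∧ p.2 ∈ A) ↔ (p.2 ∈ A ∧ p.2 ∈ B)
      rw [hp, and_comm]
    rw [h1, ← Measure.snd_apply (hA.inter hB), Measure.snd_compProd, hρ.def]
  let ν : ProbabilityMeasure E := ⟨(ρ B)⁻¹ • ρ.restrict B, ⟨by
    simp [ENNReal.inv_mul_cancel h0 (measure_ne_top ρ B)]⟩⟩
  have hν : Kernel.Invariant Q (ν : Measure E) := by
    change ((ρ B)⁻¹ • ρ.restrict B).bind Q = (ρ B)⁻¹ • ρ.restrict B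
    rw [Measure.comp_smul, hinv]
  have heq : ν = ⟨ρ, inferInstance⟩ := hQ.unique hν hρ
  have heq' : (ρ B)⁻¹ • ρ.restrict B = ρ := congrArg Subtype.val heq
  rw [← heq']
  simp [Measure.restrict_apply hB.compl]

/-- Bounded harmonic functions of a uniquely ergodic kernel are almost surely constant. -/
theorem UniquelyErgodic.exists_ae_eq_const (hQ : UniquelyErgodic Q) {ρ : Measure E}
    [IsProbabilityMeasure ρ] (hρ : Kernel.Invariant Q ρ) {F : E → ℝ} (hF : Measurable F) {C : ℝ}
    (hC : ∀ x, |F x| ≤ C) (hharm : ∀ x, ∫ y, F y ∂(Q x) = F x) :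
    ∃ c, F =ᵐ[ρ] fun _ => c := by
  have hb2 : ∀ x y, ‖F x * F y‖ ≤ C ^ 2 := fun x y => by
    rw [norm_mul, sq]
    exact mul_le_mul (hC x) (hC y) (norm_nonneg _) ((abs_nonneg _).trans (hC x))
  have hi11 : Integrable (fun p : E × E => F p.1 * F p.1) (ρ ⊗ₘ Q) :=
    Integrable.of_bound (by fun_prop) (C ^ 2) (ae_of_all _ fun p => hb2 _ _)
  have hi12 : Integrable (fun p : E × E => F p.1 * F p.2) (ρ ⊗ₘ Q) :=
    Integrable.of_bound (by fun_prop) (C ^ 2) (ae_of_all _ fun p => hb2 _ _)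
  have hi22 : Integrable (fun p : E × E => F p.2 * F p.2) (ρ ⊗ₘ Q) :=
    Integrable.of_bound (by fun_prop) (C ^ 2) (ae_of_all _ fun p => hb2 _ _)
  have h11 : ∫ p, F p.1 * F p.1 ∂(ρ ⊗ₘ Q) = ∫ x, F x * F x ∂ρ := by
    rw [Measure.integral_compProd hi11]; simp
  have h12 : ∫ p, F p.1 * F p.2 ∂(ρ ⊗ₘ Q) = ∫ x, F x * F x ∂ρ := by
    rw [Measure.integral_compProd hi12]
    simp_rw [integral_const_mul, hharm]
  have h22 : ∫ p, F p.2 * F p.2 ∂(ρ ⊗ₘ Q) = ∫ x, F x * F x ∂ρ := by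
    have hs : (ρ ⊗ₘ Q).map Prod.snd = ρ := by
      have := Measure.snd_compProd ρ Q
      rwa [hρ.def] at this
    conv_rhs => rw [← hs]
    rw [integral_map measurable_snd.aemeasurable (by fun_prop)]
  -- Expand the square: the cross term is ∫ F² by harmonicity, the last one by invariance. Thus F
  -- does not change along a step, and its preimages of measurable sets are trivial.
  have hsq : ∫ p, (F p.1 - F p.2) ^ 2 ∂(ρ ⊗ₘ Q) = 0 := by
    have : ∀ p : E × E, (F p.1 - F p.2) ^ 2
        = F p.1 * F p.1 - 2 * (F p.1 * F p.2) + F p.2 * F p.2 := fun p => by ring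
    simp_rw [this]
    have hi : Integrable (fun p : E × E => F p.1 * F p.1 - 2 * (F p.1 * F p.2)) (ρ ⊗ₘ Q) :=
      hi11.sub (hi12.const_mul 2)
    rw [integral_add hi hi22, integral_sub hi11 (hi12.const_mul 2),
      integral_const_mul, h11, h12, h22]
    ring
  have hae : ∀ᵐ p ∂(ρ ⊗ₘ Q), F p.1 = F p.2 := by
    have hint : Integrable (fun p : E × E => (F p.1 - F p.2) ^ 2) (ρ ⊗ₘ Q) := by
      refine ((hi11.sub (hi12.const_mul 2)).add hi22).congr (ae_of_all _ fun p => ?_)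
      simp only [Pi.add_apply, Pi.sub_apply]
      ring
    have := (integral_eq_zero_iff_of_nonneg (fun p => sq_nonneg _) hint).1 hsq
    filter_upwards [this] with p hp
    exact sub_eq_zero.1 (pow_eq_zero_iff two_ne_zero |>.1 hp)
  refine exists_eventuallyEq_const_of_forall_separating MeasurableSet fun U hU => ?_
  have hpre : MeasurableSet (F ⁻¹' U) := hF hU
  rcases hQ.measure_eq_zero_or_compl hρ hpre (by
    filter_upwards [hae] with p hp
    simp [hp]) with h | h
  · right
    exact measure_eq_zero_iff_ae_notMem.1 h
  · left
    exact measure_eq_zero_iff_ae_notMem.1 h |>.mono fun x hx => not_not.1 hx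

/-- Shift-invariant events are trivial for the stationary chain of a uniquely ergodic kernel. -/
theorem UniquelyErgodic.shift_invariant_zero_or_compl (hQ : UniquelyErgodic Q) {ρ : Measure E}
    [IsProbabilityMeasure ρ] (hρ : Kernel.Invariant Q ρ) {Λ : Set (ℕ → E)} (hΛ : MeasurableSet Λ)
    (hinv : pathShift ⁻¹' Λ = Λ) :
    ρ.bind (pathKernel Q) Λ = 0 ∨ ρ.bind (pathKernel Q) Λᶜ = 0 := by
  set M := ρ.bind (pathKernel Q)
  have hchain : IsMarkovChain Q (fun i (x : ℕ → E) => x i) M := isMarkovChain_bind_pathKernel Q ρ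
  have hlaw : ∀ n, M.map (fun x : ℕ → E => x n) = ρ := by
    intro n
    induction n with
    | zero => exact map_zero_bind_pathKernel Q ρ
    | succ n ih => rw [hchain.map_succ, ih, hρ.def]
  have hpre : ∀ n, (fun (x : ℕ → E) i => x (n + i)) ⁻¹' Λ = Λ := by
    intro n
    induction n with
    | zero => simp
    | succ n ih =>
      conv_rhs => rw [← ih, ← hinv]
      rw [← Set.preimage_comp]
      congr 1
      funext x i
      simp only [pathShift, Function.comp]
      congr 1
      omega
  have hFm : Measurable fun x => pathKernel Q x Λ := Kernel.measurable_coe _ hΛ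
  -- The probability of Λ given the starting point is harmonic: condition on the first step and use
  -- shift invariance.
  have hharm : ∀ x, ∫⁻ y, pathKernel Q y Λ ∂(Q x) = pathKernel Q x Λ := by
    intro x
    have hc := isMarkovChain_bind_pathKernel Q (Measure.dirac x)
    rw [Measure.dirac_bind (pathKernel Q).measurable] at hc
    have h1 := hc.map_shift 1
    have h0 : (pathKernel Q x).map (fun y => y 0) = Measure.dirac x := by
      rw [← Kernel.map_apply _ (by fun_prop), pathKernel_map_zero, Kernel.id_apply]
    rw [hc.map_succ 0, h0, Measure.dirac_bind Q.measurable] at h1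
    have h2 := congrArg (fun m => m Λ) h1
    rw [Measure.map_apply (by fun_prop) hΛ, hpre 1,
      Measure.bind_apply hΛ (pathKernel Q).measurable.aemeasurable] at h2
    exact h2.symm
  obtain ⟨c, hc⟩ := hQ.exists_ae_eq_const hρ (F := fun x => (pathKernel Q x).real Λ)
    hFm.ennreal_toReal (C := 1) (fun x => by
      rw [abs_of_nonneg measureReal_nonneg]; exact measureReal_le_one) (fun x => by
      simp only [Measure.real]
      rw [integral_toReal hFm.aemeasurable (ae_of_all _ fun y => measure_lt_top _ _), hharm])
  have hc' : ∀ᵐ x ∂ρ, pathKernel Q x Λ = ENNReal.ofReal c := by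
    filter_upwards [hc] with x hx
    rw [← hx, ofReal_measureReal]
  have : IsFiniteMeasure (ENNReal.ofReal c • M) := Measure.smul_finite M ENNReal.ofReal_ne_top
  -- Given the past up to n, the probability of Λ is that of a chain started at x n, which is c
  -- since x n has law ρ. So Λ is independent of every cylinder, and therefore of itself.
  have hmeas : M.restrict Λ = ENNReal.ofReal c • M := by
    refine measure_pi_nat_ext fun n => ?_
    ext B hB
    have hm : Measurable fun (x : ℕ → E) (j : Finset.Iic n) => x (j : ℕ) := by fun_prop
    set A := (fun (x : ℕ → E) (j : Finset.Iic n) => x (j : ℕ)) ⁻¹' B with hA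
    have hAm : MeasurableSet A := hm hB
    rw [Measure.map_apply hm hB, Measure.map_apply hm hB, ← hA, Measure.restrict_apply hAm,
      Measure.smul_apply, smul_eq_mul]
    have h1 := congrArg (fun m => m Λ) (hchain.map_shift_restrict n hB)
    rw [Measure.map_apply (by fun_prop) hΛ, hpre n, ← hA, Measure.restrict_apply hΛ,
      Measure.bind_apply hΛ (pathKernel Q).measurable.aemeasurable] at h1
    have hle : (M.restrict A).map (fun x : ℕ → E => x n) ≤ ρ := by
      rw [← hlaw n]
      exact Measure.map_mono Measure.restrict_le_self (by fun_prop)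
    rw [Set.inter_comm, h1, lintegral_congr_ae (hle.absolutelyContinuous.ae_le hc'),
      lintegral_const, Measure.map_apply (by fun_prop) .univ]
    simp
  have h3 := congrArg (fun m => m Λᶜ) hmeas
  have h4 := congrArg (fun m => m Λ) hmeas
  simp only [Measure.smul_apply, smul_eq_mul] at h3 h4
  rw [Measure.restrict_apply hΛ.compl, Set.compl_inter_self, measure_empty] at h3
  rw [Measure.restrict_apply hΛ, Set.inter_self] at h4
  rcases mul_eq_zero.1 h3.symm with h5 | h5
  · left; rw [h4, h5, zero_mul]
  · exact Or.inr h5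

theorem measurePreserving_pathShift {ρ : Measure E} [IsProbabilityMeasure ρ]
    (hρ : Kernel.Invariant Q ρ) :
    MeasurePreserving pathShift (ρ.bind (pathKernel Q)) (ρ.bind (pathKernel Q)) := by
  refine ⟨measurable_pathShift, ?_⟩
  have hc := isMarkovChain_bind_pathKernel Q ρ
  have h1 := hc.map_shift 1
  rw [hc.map_succ 0, map_zero_bind_pathKernel, hρ.def] at h1
  rw [← h1]
  congr 1
  funext x i
  simp [pathShift, add_comm]

theorem birkhoffSum_pathShift {α : Type*} (h : α → ℝ) (n : ℕ) (x : ℕ → α) :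
    birkhoffSum pathShift (fun x => h (x 0)) n x = ∑ i ∈ Finset.range n, h (x i) := by
  have : ∀ i j, pathShift^[i] x j = x (i + j) := by
    intro i
    induction i with
    | zero => simp
    | succ i ih =>
      intro j
      rw [Function.iterate_succ_apply', pathShift, ih]
      congr 1
      omega
  simp [birkhoffSum, this]

/-- Shifting the path changes partial sums by the fixed amount g (x 0), so boundedness above is
shift-invariant and has probability 0 or 1. If it were 0, some partial sum would almost surely be
positive, and the maximal ergodic theorem would contradict the negative mean. -/
theorem UniquelyErgodic.ae_bddAbove_sum (hQ : UniquelyErgodic Q) {ρ : Measure E}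
    [IsProbabilityMeasure ρ] (hρ : Kernel.Invariant Q ρ) {g : E → ℝ} (hg : Measurable g) {C : ℝ}
    (hC : ∀ x, |g x| ≤ C) (hneg : ∫ x, g x ∂ρ < 0) :
    ∀ᵐ x ∂(ρ.bind (pathKernel Q)),
      ∃ b : ℕ, ∀ n, ∑ i ∈ Finset.range n, g (x i) ≤ b := by
  let Λ : Set (ℕ → E) := {x | ∃ b : ℕ, ∀ n, ∑ i ∈ Finset.range n, g (x i) ≤ b}
  have hΛ : MeasurableSet Λ := by
    have : Λ = ⋃ b : ℕ, ⋂ n : ℕ, {x | ∑ i ∈ Finset.range n, g (x i) ≤ b} := by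
      ext x; simp [Λ]
    rw [this]
    refine MeasurableSet.iUnion fun b => MeasurableSet.iInter fun n => ?_
    exact measurableSet_le (by fun_prop) measurable_const
  have hinv : pathShift ⁻¹' Λ = Λ := by
    ext x
    constructor
    · rintro ⟨b, hb⟩
      obtain ⟨b', hb'⟩ := exists_nat_ge (b + g (x 0))
      refine ⟨max b' 0, fun n => ?_⟩
      cases n with
      | zero => simp
      | succ n =>
        rw [Finset.sum_range_succ']
        have := hb n
        simp only [pathShift] at this
        push_cast
        exact le_max_of_le_left (by linarith)
    · rintro ⟨b, hb⟩
      obtain ⟨b', hb'⟩ := exists_nat_ge (b - g (x 0))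
      refine ⟨b', fun n => ?_⟩
      have := hb (n + 1)
      rw [Finset.sum_range_succ'] at this
      simp only [pathShift]
      linarith
  rcases hQ.shift_invariant_zero_or_compl hρ hΛ hinv with h | h
  · exfalso
    have hpos : ∀ᵐ x ∂(ρ.bind (pathKernel Q)), ∃ N,
        0 < birkhoffSum pathShift (fun x => g (x 0)) N x := by
      filter_upwards [measure_eq_zero_iff_ae_notMem.1 h] with x hx
      by_contra! hcon
      exact hx ⟨0, fun n => by simpa [birkhoffSum_pathShift] using hcon n⟩
    have h1 := (measurePreserving_pathShift hρ).integral_nonneg_of_ae_exists_birkhoffSum_pos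
      (hg.comp (measurable_pi_apply 0)) (fun x => hC (x 0)) hpos
    simp only [Function.comp_def] at h1
    rw [← integral_map (φ := fun x : ℕ → E => x 0) (f := g)
      (measurable_pi_apply 0).aemeasurable hg.aestronglyMeasurable,
      map_zero_bind_pathKernel] at h1
    exact absurd hneg (not_lt.2 h1)
  · exact measure_eq_zero_iff_ae_notMem.1 h |>.mono fun x hx => not_not.1 hx

/-- For rational q above the mean, the sums of h - q stay below some b, so the averages of h are at
most q + b / n. Rational q keep the exceptional set null. -/
theorem UniquelyErgodic.ae_eventually_average_lt (hQ : UniquelyErgodic Q) {ρ : Measure E}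
    [IsProbabilityMeasure ρ] (hρ : Kernel.Invariant Q ρ) {h : E → ℝ} (hh : Measurable h) {C : ℝ}
    (hC : ∀ x, |h x| ≤ C) :
    ∀ᵐ x ∂(ρ.bind (pathKernel Q)), ∀ a > ∫ y, h y ∂ρ,
      ∀ᶠ n : ℕ in atTop, (∑ i ∈ Finset.range n, h (x i)) / n < a := by
  have hint : Integrable h ρ := Integrable.of_bound hh.aestronglyMeasurable C (ae_of_all _ hC)
  have hall : ∀ᵐ x ∂(ρ.bind (pathKernel Q)), ∀ q : ℚ, ∫ y, h y ∂ρ < q →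
      ∃ b : ℕ, ∀ n, ∑ i ∈ Finset.range n, (h (x i) - q) ≤ b := by
    rw [ae_all_iff]
    intro q
    by_cases hq : ∫ y, h y ∂ρ < q
    · filter_upwards [hQ.ae_bddAbove_sum hρ (g := fun x => h x - q) (hh.sub_const _)
        (C := C + |(q : ℝ)|) (fun x => (abs_sub _ _).trans (by gcongr; exact hC x)) (by
          rw [integral_sub hint (integrable_const _)]; simpa using hq)] with x hx _
      exact hx
    · exact ae_of_all _ fun x hx => absurd hx hq
  filter_upwards [hall] with x hx a ha
  obtain ⟨q, hq1, hq2⟩ := exists_rat_btwn ha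
  obtain ⟨b, hb⟩ := hx q hq1
  have hlim : Tendsto (fun n : ℕ => (b : ℝ) / n + q) atTop (𝓝 (0 + q)) :=
    (tendsto_const_div_atTop_nhds_zero_nat _).add_const _
  rw [zero_add] at hlim
  filter_upwards [hlim.eventually_lt_const hq2, eventually_gt_atTop 0] with n hn hn0
  refine lt_of_le_of_lt ?_ hn
  have h1 := hb n
  have hn0' : (0 : ℝ) < n := by exact_mod_cast hn0
  simp only [Finset.sum_sub_distrib, Finset.sum_const, Finset.card_range, nsmul_eq_mul] at h1
  rw [div_add' _ _ _ hn0'.ne']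
  gcongr
  linarith

/-- **Pointwise ergodic theorem** for the stationary chain of a uniquely ergodic kernel. -/
theorem UniquelyErgodic.ae_tendsto_average (hQ : UniquelyErgodic Q) {ρ : Measure E}
    [IsProbabilityMeasure ρ] (hρ : Kernel.Invariant Q ρ) {h : E → ℝ} (hh : Measurable h) {C : ℝ}
    (hC : ∀ x, |h x| ≤ C) :
    ∀ᵐ x ∂(ρ.bind (pathKernel Q)),
      Tendsto (fun n : ℕ => (∑ i ∈ Finset.range n, h (x i)) / n) atTop (𝓝 (∫ y, h y ∂ρ)) := by
  filter_upwards [hQ.ae_eventually_average_lt hρ hh hC,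
    hQ.ae_eventually_average_lt hρ hh.neg (C := C) fun x => by simpa using hC x] with x h1 h2
  refine tendsto_order.2 ⟨fun a ha => ?_, h1⟩
  have h3 := h2 (-a) (by simpa [integral_neg] using ha)
  filter_upwards [h3] with n hn
  simpa [Finset.sum_neg_distrib, neg_div] using hn

end Ergodic

/-! ### Chains started from a set of full measure -/

theorem MeasureTheory.Measure.bind_comap {α β γ : Type*} [MeasurableSpace α] [MeasurableSpace β]
    [MeasurableSpace γ] (μ : Measure α) (P : Kernel β γ) {e : α → β} (he : Measurable e) :
    μ.bind (P.comap e he) = (μ.map e).bind P := by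
  ext s hs
  rw [Measure.bind_apply hs (Kernel.measurable _).aemeasurable,
    Measure.bind_apply hs P.measurable.aemeasurable, lintegral_map (P.measurable_coe hs) he]
  rfl

/-- If the kernel `P.comap e he` is uniquely ergodic, then the time averages of countably many
bounded functions converge along every chain which starts in a suitable set of full measure. -/
theorem UniquelyErgodic.exists_forall_ae_tendsto_average {X E : Type*} [MeasurableSpace X]
    [MeasurableSpace E] {P : Kernel X E} [IsMarkovKernel P] {e : E → X} {he : Measurable e}
    (hQ : UniquelyErgodic (P.comap e he)) {π : Measure X} [IsProbabilityMeasure π]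
    (hinv : Kernel.Invariant (P.comap e he) (π.bind P))
    {ι : Type*} [Countable ι] {h : ι → E → ℝ}
    (hh : ∀ i, Measurable (h i)) {C : ℝ} (hC : ∀ i x, |h i x| ≤ C) :
    ∃ G : Set X, MeasurableSet G ∧ π G = 1 ∧
      ∀ (Ω : Type v) [MeasurableSpace Ω] (μ : Measure Ω) [IsProbabilityMeasure μ] (z : ℕ → Ω → E),
        IsMarkovChain (P.comap e he) z μ → (∀ᵐ ω ∂μ, e (z 0 ω) ∈ G) →
        ∀ᵐ ω ∂μ, ∀ i, Tendsto (fun n : ℕ => (∑ j ∈ Finset.range n, h i (z j ω)) / n) atTop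
          (𝓝 (∫ y, h i y ∂(π.bind P))) := by
  let Γ : Set (ℕ → E) := {x | ∀ i, Tendsto
    (fun n : ℕ => (∑ j ∈ Finset.range n, h i (x j)) / n) atTop (𝓝 (∫ y, h i y ∂(π.bind P)))}
  have hΓ : ((π.bind P).bind (pathKernel (P.comap e he))) Γᶜ = 0 :=
    ae_all_iff.2 fun i => hQ.ae_tendsto_average hinv (hh i) (hC i)
  -- A measurable null cover of the bad paths makes it unnecessary to prove Γ measurable.
  set N := toMeasurable ((π.bind P).bind (pathKernel (P.comap e he))) Γᶜ
  have hN : MeasurableSet N := measurableSet_toMeasurable _ _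
  have hN0 : ((π.bind P).bind (pathKernel (P.comap e he))) N = 0 := by
    rw [measure_toMeasurable, hΓ]
  have hsub : Γᶜ ⊆ N := subset_toMeasurable _ _
  let R : Kernel X (ℕ → E) := pathKernel (P.comap e he) ∘ₖ P
  have hassoc : ∀ m : Measure X, (m.bind P).bind (pathKernel (P.comap e he)) = m.bind R :=
    fun m => Measure.comp_assoc
  have hRm : Measurable fun x => R x N := R.measurable_coe hN
  -- R x is the law of the path from the second state on when the first state has image x under e.
  -- Its mass on N has π-integral 0, hence vanishes π-almost everywhere.
  refine ⟨{x | R x N = 0}, hRm (measurableSet_singleton 0), ?_, ?_⟩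
  · rw [hassoc, Measure.bind_apply hN R.measurable.aemeasurable, lintegral_eq_zero_iff hRm] at hN0
    exact prob_compl_eq_zero_iff (hRm (measurableSet_singleton 0)) |>.1 hN0
  · intro Ω _ μ _ z hz hG
    have h1 := hz.map_shift 1
    rw [hz.map_succ 0, Measure.bind_comap, Measure.map_map he (hz.measurable 0), hassoc] at h1
    have h2 : μ.map (fun ω i => z (1 + i) ω) N = 0 := by
      rw [h1, Measure.bind_apply hN R.measurable.aemeasurable,
        lintegral_map hRm (he.comp (hz.measurable 0))]
      exact (lintegral_eq_zero_iff (hRm.comp (he.comp (hz.measurable 0)))).2 hG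
    have hm : Measurable fun ω i => z (1 + i) ω :=
      measurable_pi_lambda _ fun i => hz.measurable _
    rw [Measure.map_apply hm hN, measure_eq_zero_iff_ae_notMem] at h2
    filter_upwards [h2] with ω hω i
    have h3 : (fun i => z (1 + i) ω) ∈ Γ := not_not.1 fun hcon => hω (hsub hcon)
    refine tendsto_average_of_tendsto_average_succ (u := fun j => h i (z j ω)) ?_
    simpa only [add_comm 1] using h3 i

/-! ### Random weights -/

/-- Centred i.i.d. weights average out along any independent bounded sequence. -/
theorem ae_tendsto_average_weight_mul {Ω α E : Type*} [MeasurableSpace Ω] [MeasurableSpace α]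
    [MeasurableSpace E] {μ : Measure Ω} [IsProbabilityMeasure μ] {S : ℕ → Ω → α} {z : ℕ → Ω → E}
    (hS : ∀ i, Measurable (S i)) (hz : ∀ i, Measurable (z i)) (hindep : iIndepFun S μ)
    (hident : ∀ i, IdentDistrib (S i) (S 0) μ μ)
    (hSz : IndepFun (fun ω i => S i ω) (fun ω i => z i ω) μ) {a : α → ℝ} (ha : Measurable a)
    {A : ℝ} (hA : ∀ s, |a s| ≤ A) {f : E → ℝ} (hf : Measurable f) {C : ℝ} (hC : ∀ x, |f x| ≤ C) :
    ∀ᵐ ω ∂μ, Tendsto (fun n : ℕ => (∑ i ∈ Finset.range n,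
      (a (S i ω) - ∫ ω', a (S 0 ω') ∂μ) * f (z i ω)) / n) atTop (𝓝 0) := by
  set w := ∫ ω', a (S 0 ω') ∂μ
  have hbm : Measurable fun s => a s - w := ha.sub_const w
  have hb : ∀ s, |a s - w| ≤ A + |w| := fun s => (abs_sub _ _).trans (by gcongr; exact hA s)
  have hzero : ∀ i, ∫ ω, (a (S i ω) - w) ∂μ = 0 := by
    intro i
    have hi : Integrable (fun ω => a (S i ω)) μ :=
      Integrable.of_bound (ha.comp (hS i)).aestronglyMeasurable A (ae_of_all _ fun ω => hA _)
    rw [integral_sub hi (integrable_const _)]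
    have : ∫ ω, a (S i ω) ∂μ = w := ((hident i).comp ha).integral_eq
    simp [this]
  -- The factors f (z i) may be arbitrarily dependent: orthogonality comes from the centred
  -- independent weights alone.
  refine ae_tendsto_average_zero_of_orthogonal (C := (A + |w|) * C)
    (fun i => (hbm.comp (hS i)).mul (hf.comp (hz i))) (fun i ω => ?_) fun i j hij => ?_
  · rw [abs_mul]
    exact mul_le_mul (hb _) (hC _) (abs_nonneg _) ((abs_nonneg _).trans (hb (S i ω)))
  · have h1 : IndepFun (fun ω => (a (S i ω) - w) * (a (S j ω) - w))
        (fun ω => f (z i ω) * f (z j ω)) μ :=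
      hSz.comp (φ := fun s : ℕ → α => (a (s i) - w) * (a (s j) - w))
        (ψ := fun y : ℕ → E => f (y i) * f (y j)) (by fun_prop) (by fun_prop)
    have h2 : IndepFun (fun ω => a (S i ω) - w) (fun ω => a (S j ω) - w) μ :=
      (hindep.indepFun hij).comp hbm hbm
    calc ∫ ω, (a (S i ω) - w) * f (z i ω) * ((a (S j ω) - w) * f (z j ω)) ∂μ
        = ∫ ω, ((a (S i ω) - w) * (a (S j ω) - w)) * (f (z i ω) * f (z j ω)) ∂μ := by
          congr 1; funext ω; ring
      _ = 0 := by
          have hmi := hbm.comp (hS i)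
          have hmj := hbm.comp (hS j)
          rw [h1.integral_fun_mul_eq_mul_integral (hmi.mul hmj).aestronglyMeasurable
              ((hf.comp (hz i)).mul (hf.comp (hz j))).aestronglyMeasurable,
            h2.integral_fun_mul_eq_mul_integral hmi.aestronglyMeasurable hmj.aestronglyMeasurable,
            hzero i, zero_mul, zero_mul]

/-! ### Weak convergence of the empirical measures -/

section Recycled

variable {X : Type*} [MeasurableSpace X] {K : ℕ}

theorem recycledEmpirical_apply (S : ℕ → Finset (Fin K)) (z : ℕ → Fin (K + 1) → X) (N : ℕ)
    {V : Set X} (hV : MeasurableSet V) :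
    ((recycledEmpirical S z N V : ℝ≥0) : ℝ)
      = (∑ k, ∑ i ∈ Finset.range N,
          (if k ∈ S i then 1 else 0) * V.indicator (fun _ => (1 : ℝ)) (z i k.succ))
        / ∑ k, ∑ i ∈ Finset.range N, if k ∈ S i then (1 : ℝ) else 0 := by
  have h1 : ∀ (T : Finset ℕ), (((∑ i ∈ T, ∑ k ∈ S i, (diracProba (z i k.succ)).toFiniteMeasure :
      FiniteMeasure X) V : ℝ≥0) : ℝ)
      = ∑ i ∈ T, ∑ k ∈ S i, V.indicator (fun _ => (1 : ℝ)) (z i k.succ) := by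
    intro T
    rw [← FiniteMeasure.measureReal_eq_coe_coeFn, FiniteMeasure.toMeasure_sum,
      measureReal_def, Measure.finsetSum_apply, ENNReal.toReal_sum fun i _ => measure_ne_top _ _]
    refine Finset.sum_congr rfl fun i _ => ?_
    rw [FiniteMeasure.toMeasure_sum, Measure.finsetSum_apply,
      ENNReal.toReal_sum fun i _ => measure_ne_top _ _]
    refine Finset.sum_congr rfl fun k _ => ?_
    change ((diracProba (z i k.succ)).toMeasure V).toReal = _
    rw [diracProba_toMeasure_apply' _ hV]
    by_cases h : z i k.succ ∈ V <;> simp [h]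
  rw [recycledEmpirical, FiniteMeasure.smul_apply, smul_eq_mul, NNReal.coe_mul, h1,
    Finset.sum_comm, Finset.sum_comm (s := Finset.univ), div_eq_inv_mul]
  congr 1
  · simp
  · simp

theorem recycledEmpirical_isProbabilityMeasure (S : ℕ → Finset (Fin K))
    (z : ℕ → Fin (K + 1) → X) {N : ℕ}
    (hN : 0 < ∑ k, ∑ i ∈ Finset.range N, if k ∈ S i then (1 : ℝ) else 0) :
    IsProbabilityMeasure (recycledEmpirical S z N : Measure X) := by
  have h := recycledEmpirical_apply S z N MeasurableSet.univ
  simp only [Set.indicator_univ, mul_one, div_self hN.ne'] at h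
  refine ⟨?_⟩
  rw [← FiniteMeasure.ennreal_coeFn_eq_coeFn_toMeasure, NNReal.coe_eq_one.1 h, ENNReal.coe_one]

/-- Weak convergence of the recycled empirical measures, tested on a π-system of small open
neighbourhoods and on the numbers of selected states. -/
theorem tendsto_recycledEmpirical [TopologicalSpace X] [SecondCountableTopology X]
    [OpensMeasurableSpace X] {𝒞 : Set (Set X)} (h𝒞 : IsPiSystem 𝒞)
    (hmeas : ∀ V ∈ 𝒞, MeasurableSet V)
    (hnhds : ∀ U : Set X, IsOpen U → ∀ x ∈ U, ∃ V ∈ 𝒞, V ∈ 𝓝 x ∧ V ⊆ U)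
    {π : ProbabilityMeasure X} {S : ℕ → Finset (Fin K)} {z : ℕ → Fin (K + 1) → X} {w : Fin K → ℝ}
    (hw : 0 < ∑ k, w k)
    (hcount : ∀ k, Tendsto (fun n : ℕ => (∑ i ∈ Finset.range n, if k ∈ S i then (1 : ℝ) else 0) / n)
      atTop (𝓝 (w k)))
    (hconv : ∀ V ∈ 𝒞, ∀ k, Tendsto (fun n : ℕ => (∑ i ∈ Finset.range n,
      (if k ∈ S i then 1 else 0) * V.indicator (fun _ => (1 : ℝ)) (z i k.succ)) / n)
      atTop (𝓝 (w k * (π : Measure X).real V))) :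
    Tendsto (recycledEmpirical S z) atTop (𝓝 π.toFiniteMeasure) := by
  have hden : Tendsto (fun n : ℕ => (∑ k, ∑ i ∈ Finset.range n, if k ∈ S i then (1 : ℝ) else 0) / n)
      atTop (𝓝 (∑ k, w k)) := by
    simp_rw [Finset.sum_div]
    simp_rw [← Finset.sum_div (Finset.range _)]
    exact tendsto_finsetSum _ fun k _ => hcount k
  have hpos : ∀ᶠ n : ℕ in atTop,
      0 < ∑ k, ∑ i ∈ Finset.range n, if k ∈ S i then (1 : ℝ) else 0 := by
    filter_upwards [hden.eventually_const_lt hw, eventually_gt_atTop 0] with n hn hn0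
    have : (0 : ℝ) < n := by exact_mod_cast hn0
    exact (div_pos_iff_of_pos_right this).1 hn
  let p : ℕ → ProbabilityMeasure X := fun n =>
    if h : 0 < ∑ k, ∑ i ∈ Finset.range n, if k ∈ S i then (1 : ℝ) else 0 then
      ⟨recycledEmpirical S z n, recycledEmpirical_isProbabilityMeasure S z h⟩ else π
  have hp : ∀ᶠ n in atTop, (p n).toFiniteMeasure = recycledEmpirical S z n := by
    filter_upwards [hpos] with n hn
    rw [show p n = _ from dif_pos hn]
    rfl
  have hlim : Tendsto p atTop (𝓝 π) := by
    refine h𝒞.tendsto_probabilityMeasure_of_tendsto_of_mem hmeas hnhds fun V hV => ?_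
    rw [← NNReal.tendsto_coe]
    have hnum : Tendsto (fun n : ℕ => (∑ k, ∑ i ∈ Finset.range n,
        (if k ∈ S i then 1 else 0) * V.indicator (fun _ => (1 : ℝ)) (z i k.succ)) / n)
        atTop (𝓝 ((∑ k, w k) * (π : Measure X).real V)) := by
      rw [Finset.sum_mul]
      refine (tendsto_finsetSum Finset.univ fun k _ => hconv V hV k).congr fun n => ?_
      rw [Finset.sum_div]
    have hquot := hnum.div hden hw.ne'
    rw [mul_div_cancel_left₀ _ hw.ne'] at hquot
    refine hquot.congr' ?_
    filter_upwards [hp, eventually_gt_atTop 0] with n hn hn0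
    have hn0' : (n : ℝ) ≠ 0 := by positivity
    rw [← ProbabilityMeasure.toFiniteMeasure_apply, hn, recycledEmpirical_apply S z n (hmeas V hV)]
    simp only [Pi.div_apply]
    rw [div_div_div_cancel_right₀ hn0']
  exact ((ProbabilityMeasure.toFiniteMeasure_continuous.tendsto π).comp hlim).congr' hp

end Recycled

/-- Finite intersections of members of a countable basis are still countably many and open, and are
closed under intersection. -/
theorem TopologicalSpace.exists_countable_isPiSystem_nhds (X : Type*) [TopologicalSpace X]
    [SecondCountableTopology X] :
    ∃ 𝒞 : Set (Set X), 𝒞.Countable ∧ IsPiSystem 𝒞 ∧ (∀ V ∈ 𝒞, IsOpen V) ∧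
      ∀ U : Set X, IsOpen U → ∀ x ∈ U, ∃ V ∈ 𝒞, V ∈ 𝓝 x ∧ V ⊆ U := by
  refine ⟨Set.sInter '' {t | t.Finite ∧ t ⊆ countableBasis X},
    (Set.countable_ofPred_finite_subset (countable_countableBasis X)).image _, ?_, ?_, ?_⟩
  · rintro _ ⟨s, ⟨hs, hs'⟩, rfl⟩ _ ⟨t, ⟨ht, ht'⟩, rfl⟩ -
    exact ⟨s ∪ t, ⟨hs.union ht, Set.union_subset hs' ht'⟩, Set.sInter_union s t⟩
  · rintro _ ⟨s, ⟨hs, hs'⟩, rfl⟩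
    exact hs.isOpen_sInter fun V hV => isOpen_of_mem_countableBasis (hs' hV)
  · intro U hU x hx
    obtain ⟨V, hV, hxV, hVU⟩ := (isBasis_countableBasis X).exists_subset_of_mem_open hx hU
    exact ⟨V, ⟨{V}, ⟨Set.finite_singleton V, Set.singleton_subset_iff.2 hV⟩, Set.sInter_singleton V⟩,
      (isOpen_of_mem_countableBasis hV).mem_nhds hxV, hVU⟩

/-! ### Unique ergodicity of the product chain and conclusion -/

/-- A kernel which depends on the state only through `e`, and whose image under `e` is uniquely
ergodic, is uniquely ergodic. -/
theorem UniquelyErgodic.comap {X E : Type*} [MeasurableSpace X] [MeasurableSpace E]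
    {P : Kernel X E} [IsMarkovKernel P] {e : E → X} (he : Measurable e)
    (hP : UniquelyErgodic (P.map e)) {π : ProbabilityMeasure X}
    (hπ : Kernel.Invariant (P.map e) (π : Measure X)) :
    Kernel.Invariant (P.comap e he) ((π : Measure X).bind P) ∧ UniquelyErgodic (P.comap e he) := by
  have hinv : Kernel.Invariant (P.comap e he) ((π : Measure X).bind P) := by
    rw [Kernel.Invariant, Measure.bind_comap, Measure.map_comp _ _ he, hπ.def]
  refine ⟨hinv, ⟨(π : Measure X).bind P, inferInstance⟩, hinv, fun ν hν => ?_⟩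
  -- An invariant ν is recovered from its image under e by one step of P, and that image is itself
  -- invariant for `P.map e`, hence is π.
  have h1 : ((ν : Measure E).map e).bind P = ν := by
    rw [← Measure.bind_comap _ _ he, hν.def]
  have h2 : Kernel.Invariant (P.map e) ((ν : Measure E).map e) := by
    rw [Kernel.Invariant, ← Measure.map_comp _ _ he, h1]
  have h3 : ν.map he.aemeasurable = π := hP.unique h2 hπ
  have h4 : (ν : Measure E).map e = π := congrArg Subtype.val h3
  refine Subtype.ext ?_
  change (ν : Measure E) = (π : Measure X).bind P
  rw [← h4, h1]

theorem theorem4 {X : Type u} [TopologicalSpace X] [SecondCountableTopology X]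
    [MeasurableSpace X] [BorelSpace X] (K : ℕ)
    -- the transition kernels `P_0, …, P_K` with common stationary law `π`
    (κ : Fin (K + 1) → Kernel X X) [∀ k, IsMarkovKernel (κ k)]
    (π : ProbabilityMeasure X) (hπ : ∀ k, Kernel.Invariant (κ k) (π : Measure X))
    (hue : UniquelyErgodic (κ 0))
    -- the transition kernel of the chain on the product space
    (Q : Kernel (Fin (K + 1) → X) (Fin (K + 1) → X)) [IsMarkovKernel Q]
    (P : Kernel X (Fin (K + 1) → X))
    (hQ : ∀ x : Fin (K + 1) → X, Q x = P (x 0))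
    (hP : ∀ (k : Fin (K + 1)) (x₀ : X), (P x₀).map (fun y => y k) = κ k x₀) :
    ∃ G : Set X, MeasurableSet G ∧ (π : Measure X) G = 1 ∧
      ∀ (Ω : Type v) [MeasurableSpace Ω] (μ : Measure Ω) [IsProbabilityMeasure μ]
        (z : ℕ → Ω → Fin (K + 1) → X) (S : ℕ → Ω → Finset (Fin K)),
        IsMarkovChain Q z μ →
        (∀ᵐ ω ∂μ, z 0 ω 0 ∈ G) →
        (∀ i, Measurable (S i)) →
        iIndepFun S μ →
        (∀ i, IdentDistrib (S i) (S 0) μ μ) →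
        0 < μ {ω | (S 0 ω).Nonempty} →
        IndepFun (fun ω i => S i ω) (fun ω i => z i ω) μ →
        ∀ᵐ ω ∂μ, Tendsto
          (fun N : ℕ => recycledEmpirical (fun i => S i ω) (fun i => z i ω) N)
          atTop (𝓝 π.toFiniteMeasure) := by
  have hQ' : Q = P.comap (fun y => y 0) (measurable_pi_apply 0) := by
    ext1 x
    exact hQ x
  have hPmap : ∀ k, P.map (fun y => y k) = κ k := by
    intro k
    ext1 x
    rw [Kernel.map_apply _ (measurable_pi_apply k), hP]
  have : IsMarkovKernel P := ⟨fun x => ⟨by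
    have h := congrArg (fun m => m Set.univ) (hP 0 x)
    rwa [Measure.map_apply (measurable_pi_apply 0) .univ, Set.preimage_univ,
      measure_univ (μ := κ 0 x)] at h⟩⟩
  subst hQ'
  obtain ⟨hinv, hueQ⟩ := UniquelyErgodic.comap (P := P) (π := π) (measurable_pi_apply 0)
    (by rwa [hPmap]) (by rw [hPmap]; exact hπ 0)
  have hmarg : ∀ k, ((π : Measure X).bind P).map (fun y => y k) = π := by
    intro k
    rw [Measure.map_comp _ _ (measurable_pi_apply k), hPmap, (hπ k).def]
  obtain ⟨𝒞, h𝒞c, h𝒞, h𝒞o, h𝒞n⟩ := TopologicalSpace.exists_countable_isPiSystem_nhds X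
  have : Countable 𝒞 := h𝒞c.to_subtype
  let h : 𝒞 × Fin K → (Fin (K + 1) → X) → ℝ := fun p y =>
    (p.1 : Set X).indicator (fun _ => 1) (y p.2.succ)
  have h_meas : ∀ p, Measurable (h p) := fun p =>
    (measurable_const.indicator (h𝒞o p.1 p.1.2).measurableSet).comp (measurable_pi_apply _)
  have h_le : ∀ p y, |h p y| ≤ 1 := by
    intro p y
    by_cases hy : y p.2.succ ∈ (p.1 : Set X) <;> simp [h, hy]
  have h_int : ∀ p, ∫ y, h p y ∂((π : Measure X).bind P) = (π : Measure X).real p.1 := by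
    intro p
    have hV := (h𝒞o p.1 p.1.2).measurableSet
    rw [← integral_indicator_one hV]
    conv_rhs => rw [← hmarg p.2.succ]
    rw [integral_map (measurable_pi_apply _).aemeasurable
      (measurable_const.indicator hV).aestronglyMeasurable]
    rfl
  obtain ⟨G, hG, hG1, hGconv⟩ :=
    hueQ.exists_forall_ae_tendsto_average.{v} hinv h_meas h_le
  refine ⟨G, hG, hG1, fun Ω _ μ _ z S hz hz0 hS hindep hident hne hSz => ?_⟩
  let a : Fin K → Finset (Fin K) → ℝ := fun k s => if k ∈ s then 1 else 0
  have ha : ∀ k, Measurable (a k) := fun k =>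
    Measurable.ite (measurableSet_mem_finset k) measurable_const measurable_const
  have ha_le : ∀ k s, |a k s| ≤ 1 := by
    intro k s
    by_cases hk : k ∈ s <;> simp [a, hk]
  have ha_nonneg : ∀ k s, 0 ≤ a k s := by
    intro k s
    by_cases hk : k ∈ s <;> simp [a, hk]
  let w : Fin K → ℝ := fun k => ∫ ω, a k (S 0 ω) ∂μ
  have hw : 0 < ∑ k, w k := by
    have hint : ∀ k, Integrable (fun ω => a k (S 0 ω)) μ := fun k =>
      Integrable.of_bound ((ha k).comp (hS 0)).aestronglyMeasurable 1
        (ae_of_all _ fun ω => ha_le k _)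
    -- The sum of the weights a k is the cardinality of S 0, which is positive on an event of
    -- positive probability.
    rw [← integral_finsetSum _ fun k _ => hint k, integral_pos_iff_support_of_nonneg
      (fun ω => Finset.sum_nonneg fun k _ => ha_nonneg k _) (integrable_finsetSum _ fun k _ => hint k)]
    refine hne.trans_le (measure_mono fun ω hω => ?_)
    obtain ⟨k, hk⟩ := hω
    refine (Finset.sum_pos' (fun k _ => ha_nonneg k _) ⟨k, Finset.mem_univ k, ?_⟩).ne'
    simp [a, hk]
  have hweight : ∀ᵐ ω ∂μ, ∀ p, Tendsto (fun n : ℕ => (∑ i ∈ Finset.range n,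
      (a p.2 (S i ω) - w p.2) * h p (z i ω)) / n) atTop (𝓝 0) :=
    ae_all_iff.2 fun p => ae_tendsto_average_weight_mul hS hz.measurable hindep hident hSz
      (ha p.2) (ha_le p.2) (h_meas p) (h_le p)
  have hcount : ∀ᵐ ω ∂μ, ∀ k, Tendsto (fun n : ℕ => (∑ i ∈ Finset.range n,
      (a k (S i ω) - w k) * 1) / n) atTop (𝓝 0) :=
    -- With the test function 1 the weighted averages reduce to the law of large numbers for the
    -- counts.
    ae_all_iff.2 fun k => ae_tendsto_average_weight_mul (f := fun _ => 1) (C := 1)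
      hS hz.measurable hindep hident hSz (ha k) (ha_le k) measurable_const (by simp)
  filter_upwards [hGconv Ω μ z hz hz0, hweight, hcount] with ω h1 h2 h3
  refine tendsto_recycledEmpirical h𝒞 (fun V hV => (h𝒞o V hV).measurableSet) h𝒞n (w := w) hw
    (fun k => ?_) fun V hV k => ?_
  · have h4 := (h3 k).add_const (w k)
    rw [zero_add] at h4
    refine h4.congr' ?_
    filter_upwards [eventually_gt_atTop 0] with n hn
    have hn' : (n : ℝ) ≠ 0 := by positivity
    simp only [mul_one, Finset.sum_sub_distrib, Finset.sum_const, Finset.card_range, nsmul_eq_mul]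
    field_simp
    simp [a]
  · have h4 := (h2 (⟨V, hV⟩, k)).add ((h1 (⟨V, hV⟩, k)).const_mul (w k))
    rw [zero_add, h_int] at h4
    refine h4.congr fun n => ?_
    rw [mul_div_assoc', Finset.mul_sum, ← add_div, ← Finset.sum_add_distrib]
    congr 1
    refine Finset.sum_congr rfl fun i _ => ?_
    simp only [h, a]
    ring
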